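/- Let $(n_l)_{l\ge 1}$ be a sequence of positive integers such that every positive integer divides some partial product $n_1 n_2\cdots n_L$, so that $\mathcal Q=\bigotimes_{l=1}^\infty M_{n_l}$ is the universal UHF algebra. Let $\rho_l:\mathbb Z/n_l\mathbb Z\to U(M_{n_l})$ be the natural representation by cyclic permutation matrices, $\rho_l(s)e_j=e_{j+s}$. Let $G$ be an abelian group, let $i:G\hookrightarrow\prod_{l=1}^\infty\mathbb Z/n_l\mathbb Z$ be an injective homomorphism, and let $\alpha$ be the action of $G$ on $\mathcal Q$ given by $\alpha_g=\bigotimes_{l=1}^\infty \mathrm{Ad}\,\rho_l(i(g)_l)$. An automorphism $\beta$ of $\mathcal Q$ is called *uniformly outer* if for every $a\in\mathcal Q$, every non-zero projection $p\in\mathcal Q$ and every $\varepsilon>0$ there are $k>0$ and mutually orthogonal projections $p_1,\dots,p_k$ with $p=p_1+\cdots+p_k$ and $\|p_j\,a\,\beta(p_j)\|<\varepsilon$ for $1\le j\le k$. For $1\le k<\infty$, $\beta$ has the *order $k$ Rokhlin property* if for every $\varepsilon>0$ and every finite set $F\subset\mathcal Q$ there are mutually orthogonal projections $p_1,\dots,p_k$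 with $p_1+\cdots+p_k=1$ such that, for $1\le j\le k$, $\|p_ja-ap_j\|<\varepsilon$ for all $a\in F$ and $\|\beta(p_j)-p_{j+1}\|<\varepsilon$, where $p_{k+1}=p_1$; $\beta$ has the *order $\infty$ Rokhlin property* if $\beta^j$ is uniformly outer for every $j\ge1$. The action $\alpha$ has the *Rokhlin property* if, for every $g\in G$, $\alpha_g$ has the order $k(g)$ Rokhlin property, where $k(g)\in\{1,2,\dots,\infty\}$ is the order of $g$ in $G$. Then $\alpha$ has the Rokhlin property if and only if $i(G)\cap\bigoplus_{l=1}^\infty\mathbb Z/n_l\mathbb Z=0$. -/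

import Mathlib

noncomputable section

namespace UHFModel

/-! ### Uniform outerness and the Rokhlin property -/

section Rokhlin

variable {A : Type*} [CStarAlgebra A]

/-- An automorphism `α` of a unital C*-algebra is uniformly outer if, for every element `a`, every
non-zero projection `p` and every `ε > 0`, the projection `p` is a sum of finitely many mutually
orthogonal projections `q i` with `‖q i * a * α (q i)‖ < ε`. -/
def IsUniformlyOuter (α : A ≃⋆ₐ[ℂ] A) : Prop :=
  ∀ a p : A, IsStarProjection p → p ≠ 0 → ∀ ε : ℝ, 0 < ε →
    ∃ k : ℕ, 0 < k ∧ ∃ q : Fin k → A,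
      (∀ i, IsStarProjection (q i)) ∧
      (∀ i j, i ≠ j → q i * q j = 0) ∧
      p = ∑ i, q i ∧
      ∀ i, ‖q i * a * α (q i)‖ < ε

/-- The order `k` Rokhlin property of an automorphism, `1 ≤ k < ∞`; the index `i + 1` is taken
cyclically (`finRotate k` sends `i` to `i + 1` and the last index to the first one). -/
def HasFiniteOrderRokhlin (k : ℕ) (α : A ≃⋆ₐ[ℂ] A) : Prop :=
  ∀ ε : ℝ, 0 < ε → ∀ F : Finset A, ∃ p : Fin k → A,
    (∀ i, IsStarProjection (p i)) ∧
    (∀ i j, i ≠ j → p i * p j = 0) ∧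
    (∀ i, ∀ a ∈ F, ‖p i * a - a * p i‖ < ε) ∧
    (∀ i, ‖α (p i) - p (finRotate k i)‖ < ε) ∧
    ∑ i, p i = 1

/-- The order `∞` Rokhlin property of an automorphism: all its positive powers are uniformly
outer. -/
def HasInfiniteOrderRokhlin (α : A ≃⋆ₐ[ℂ] A) : Prop :=
  ∀ j : ℕ, 1 ≤ j → IsUniformlyOuter (α ^ j)

/-- An action of an (additively written) abelian group has the Rokhlin property if every `g` acts
with the order `k` Rokhlin property, where `k` is the order of `g` in the group.
(`addOrderOf g = 0` encodes that `g` has infinite order.) -/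
def HasRokhlinProperty {G : Type*} [AddCommGroup G]
    (α : Multiplicative G →* (A ≃⋆ₐ[ℂ] A)) : Prop :=
  ∀ g : G,
    (0 < addOrderOf g → HasFiniteOrderRokhlin (addOrderOf g) (α (Multiplicative.ofAdd g))) ∧
    (addOrderOf g = 0 → HasInfiniteOrderRokhlin (α (Multiplicative.ofAdd g)))

end Rokhlin

/-! ### The product and the direct sum of the cyclic groups -/

/-- The full product `∏ₗ ℤ/nₗℤ`. -/
abbrev CyclicProd (n : ℕ → ℕ) : Type := ∀ l, ZMod (n l)

/-- The direct sum `⨁ₗ ℤ/nₗℤ` as a subgroup of the product. -/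
def cyclicSum (n : ℕ → ℕ) : AddSubgroup (CyclicProd n) where
  carrier := {x | {l | x l ≠ 0}.Finite}
  zero_mem' := by simp
  add_mem' {x y} hx hy := by
    refine (Set.Finite.union hx hy).subset fun l hl => ?_
    by_contra h
    simp only [Set.mem_union, Set.mem_ofPred_eq, not_or, not_not] at h
    exact hl (by simp [h.1, h.2])
  neg_mem' {x} hx := by simpa using hx

/-- The supernatural number `∏ₗ nₗ` is the universal one: each positive integer divides a finite
partial product. This is what it means for `⨂ₗ M_{nₗ}` to be the universal UHF algebra. -/
def IsUniversalType (n : ℕ → ℕ) : Prop :=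
  ∀ k : ℕ, 0 < k → ∃ L : ℕ, k ∣ ∏ l ∈ Finset.range L, n l

/-! ### Operators on `ℓ²(∏ₗ ℤ/nₗℤ)` -/

/-- The Hilbert space `ℓ²(X)` of the underlying set `X` of `∏ₗ ℤ/nₗℤ`. -/
abbrev Hilb (n : ℕ → ℕ) : Type := lp (fun _ : CyclicProd n => ℂ) 2

section Operators

variable {n : ℕ → ℕ}

theorem memlp_comp_perm (e : Equiv.Perm (CyclicProd n)) (ξ : Hilb n) :
    Memℓp (fun x => ξ (e x)) 2 := by
  have h := lp.memℓp ξ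
  rw [memℓp_gen_iff (by simp)] at h ⊢
  exact (e.summable_iff (f := fun x => ‖ξ x‖ ^ (2 : ENNReal).toReal)).2 h

/-- The permutation unitary: `(permIso e ξ) x = ξ (e⁻¹ x)`, that is, `δ_x ↦ δ_{e x}`. -/
def permIso (e : Equiv.Perm (CyclicProd n)) : Hilb n ≃ₗᵢ[ℂ] Hilb n where
  toFun ξ := ⟨fun x => ξ (e.symm x), memlp_comp_perm e.symm ξ⟩
  invFun ξ := ⟨fun x => ξ (e x), memlp_comp_perm e ξ⟩
  map_add' _ _ := rfl
  map_smul' _ _ := rfl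
  left_inv ξ := by ext x; simp
  right_inv ξ := by ext x; simp
  norm_map' ξ := by
    rw [lp.norm_eq_tsum_rpow (by simp), lp.norm_eq_tsum_rpow (by simp)]
    congr 1
    exact e.symm.tsum_eq (fun x => ‖ξ x‖ ^ (2 : ENNReal).toReal)

@[simp]
theorem permIso_apply (e : Equiv.Perm (CyclicProd n)) (ξ : Hilb n) (x : CyclicProd n) :
    permIso e ξ x = ξ (e.symm x) := rfl

/-- The unitary of `B(ℓ²(X))` given by translation, `δ_x ↦ δ_{x + g}`. -/
def translation (n : ℕ → ℕ) :
    Multiplicative (CyclicProd n) →* unitary (Hilb n →L[ℂ] Hilb n) where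
  toFun g := Unitary.linearIsometryEquiv.symm (permIso (Equiv.addRight g.toAdd))
  map_one' := by
    rw [MulEquiv.map_eq_one_iff]
    ext ξ x
    change ξ (x + -0) = ξ x
    simp
  map_mul' g h := by
    rw [← map_mul]
    congr 1
    ext ξ x
    change ξ (x + -(g.toAdd + h.toAdd)) = ξ (x + -g.toAdd + -h.toAdd)
    rw [neg_add, add_assoc]

@[simp]
theorem translation_apply (g : CyclicProd n) (ξ : Hilb n) (x : CyclicProd n) :
    (translation n (Multiplicative.ofAdd g) : Hilb n →L[ℂ] Hilb n) ξ x = ξ (x - g) := by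
  simp [translation, sub_eq_add_neg]

@[simp]
theorem star_translation_apply (g : CyclicProd n) (ξ : Hilb n) (x : CyclicProd n) :
    (star (translation n (Multiplicative.ofAdd g) : Hilb n →L[ℂ] Hilb n)) ξ x = ξ (x + g) := by
  have h : star (translation n (Multiplicative.ofAdd g) : Hilb n →L[ℂ] Hilb n)
      = (translation n (Multiplicative.ofAdd (-g)) : Hilb n →L[ℂ] Hilb n) := by
    rw [ofAdd_neg, map_inv, ← Unitary.star_eq_inv, Unitary.coe_star]
  rw [h, translation_apply, sub_neg_eq_add]

variable [∀ l, NeZero (n l)]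

/-- Multiplication by a function that depends on the `l`-th coordinate only. -/
def diagOp (l : ℕ) (f : ZMod (n l) → ℂ) : Hilb n →L[ℂ] Hilb n :=
  have bd : ∀ (ξ : Hilb n) (x : CyclicProd n), ‖f (x l) * ξ x‖ ≤ ‖((‖f‖ : ℂ) • ξ) x‖ := by
    intro ξ x
    simp only [lp.coeFn_smul, Pi.smul_apply, smul_eq_mul, norm_mul, Complex.norm_real, norm_norm]
    exact mul_le_mul_of_nonneg_right (norm_le_pi_norm f (x l)) (norm_nonneg _)
  LinearMap.mkContinuous
    { toFun := fun ξ =>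
        ⟨fun x => f (x l) * ξ x, Memℓp.mono' (lp.memℓp ((‖f‖ : ℂ) • ξ)) (bd ξ)⟩
      map_add' := fun ξ η => by ext x; exact mul_add _ _ _
      map_smul' := fun c ξ => by ext x; exact mul_left_comm _ _ _ }
    ‖f‖ fun ξ => by
      refine (lp.norm_mono (by simp) (bd ξ)).trans ?_
      rw [norm_smul]
      simp

@[simp]
theorem diagOp_apply (l : ℕ) (f : ZMod (n l) → ℂ) (ξ : Hilb n) (x : CyclicProd n) :
    diagOp l f ξ x = f (x l) * ξ x := rfl

/-- The operator by which a matrix `a ∈ M_{nₗ}` acts on `ℓ²(X)` through the `l`-th coordinate;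
see `factorOp_apply` for the formula. -/
def factorOp (l : ℕ) (a : Matrix (ZMod (n l)) (ZMod (n l)) ℂ) : Hilb n →L[ℂ] Hilb n :=
  ∑ s : ZMod (n l), diagOp l (fun i => a i (i + s)) *
    (translation n (Multiplicative.ofAdd (-Pi.single l s)) : Hilb n →L[ℂ] Hilb n)

theorem factorOp_apply (l : ℕ) (a : Matrix (ZMod (n l)) (ZMod (n l)) ℂ) (ξ : Hilb n)
    (x : CyclicProd n) :
    factorOp l a ξ x = ∑ j, a (x l) j * ξ (Function.update x l j) := by
  have h1 : factorOp l a ξ x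
      = ∑ s, a (x l) (x l + s) * ξ (x + Pi.single l s) := by
    simp only [factorOp, sum_apply, lp.coeFn_sum, Finset.sum_apply,
      mul_apply_eq_comp, diagOp_apply, translation_apply, sub_neg_eq_add]
  rw [h1, ← Equiv.sum_comp (Equiv.addLeft (x l))
    (fun j => a (x l) j * ξ (Function.update x l j))]
  refine Finset.sum_congr rfl fun s _ => ?_
  have h2 : x + Pi.single l s = Function.update x l (x l + s) := by
    ext m
    by_cases h : m = l
    · subst h; simp
    · simp [h]
  rw [h2]
  rfl

theorem factorOp_star (l : ℕ) (a : Matrix (ZMod (n l)) (ZMod (n l)) ℂ) :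
    factorOp (n := n) l (star a) = star (factorOp l a) := by
  classical
  refine lp.ext_continuousLinearMap (by simp) fun y => ?_
  ext x
  simp only [ContinuousLinearMap.comp_apply, lp.singleContinuousLinearMap_apply]
  have h1 : (star (factorOp l a) (lp.single 2 y (1 : ℂ)) : Hilb n) x
      = star ((factorOp l a (lp.single 2 x (1 : ℂ)) : Hilb n) y) := by
    have e1 := lp.inner_single_left (𝕜 := ℂ) x (1 : ℂ)
      (star (factorOp l a) (lp.single 2 y (1 : ℂ)) : Hilb n)
    have e2 := lp.inner_single_right (𝕜 := ℂ) y (1 : ℂ)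
      (factorOp l a (lp.single 2 x (1 : ℂ)) : Hilb n)
    rw [ContinuousLinearMap.star_eq_adjoint] at e1 ⊢
    rw [ContinuousLinearMap.adjoint_inner_right, e2] at e1
    simpa using e1.symm
  rw [h1, factorOp_apply, factorOp_apply, star_sum]
  have key : ∀ u v : CyclicProd n, ∀ j : ZMod (n l),
      (lp.single 2 u (1 : ℂ) : Hilb n) (Function.update v l j)
        = if j = u l ∧ Function.update v l (u l) = u then 1 else 0 := by
    intro u v j
    rw [lp.single_apply]
    by_cases h : Function.update v l j = u
    · have hj : j = u l := by rw [← h]; simp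
      subst hj
      simp [h]
    · rw [if_neg]
      · simp [h]
      · rintro ⟨rfl, h'⟩
        exact h h'
  have sym : (Function.update x l (y l) = y) ↔ (Function.update y l (x l) = x) := by
    constructor <;> intro h
    · rw [← h]; simp
    · rw [← h]; simp
  by_cases h : Function.update x l (y l) = y
  · have h' := sym.1 h
    simp only [key, h, h', Matrix.star_apply]
    simp [apply_ite (starRingEnd ℂ)]
  · have h' : ¬ Function.update y l (x l) = x := fun q => h (sym.2 q)
    simp only [key, h, h']
    simp

/-- The `l`-th tensor factor `M_{nₗ}`, as a unital *-homomorphism into `B(ℓ²(X))`. -/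
def factorHom (n : ℕ → ℕ) [∀ l, NeZero (n l)] (l : ℕ) :
    Matrix (ZMod (n l)) (ZMod (n l)) ℂ →⋆ₐ[ℂ] (Hilb n →L[ℂ] Hilb n) where
  toFun := factorOp l
  map_one' := by
    ext ξ x
    simp [factorOp_apply, Matrix.one_apply]
  map_mul' a b := by
    ext ξ x
    simp only [mul_apply_eq_comp, factorOp_apply, Function.update_self,
      Function.update_idem, Matrix.mul_apply, Finset.sum_mul, Finset.mul_sum]
    rw [Finset.sum_comm]
    simp only [mul_assoc]
  map_zero' := by
    ext ξ x
    simp [factorOp_apply]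
  map_add' a b := by
    ext ξ x
    simp [factorOp_apply, add_mul, Finset.sum_add_distrib]
  commutes' c := by
    ext ξ x
    simp [factorOp_apply, Algebra.algebraMap_eq_smul_one, Matrix.one_apply]
  map_star' := factorOp_star l

theorem factorHom_apply (l : ℕ) (a : Matrix (ZMod (n l)) (ZMod (n l)) ℂ) (ξ : Hilb n)
    (x : CyclicProd n) :
    factorHom n l a ξ x = ∑ j, a (x l) j * ξ (Function.update x l j) :=
  factorOp_apply l a ξ x

/-- Different tensor factors commute. -/
theorem factorHom_commute {l m : ℕ} (h : l ≠ m) (a : Matrix (ZMod (n l)) (ZMod (n l)) ℂ)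
    (b : Matrix (ZMod (n m)) (ZMod (n m)) ℂ) :
    Commute (factorHom n l a) (factorHom n m b) := by
  ext ξ x
  simp only [mul_apply_eq_comp, factorHom_apply, Finset.mul_sum,
    Function.update_of_ne h, Function.update_of_ne h.symm]
  rw [Finset.sum_comm]
  refine Finset.sum_congr rfl fun j _ => Finset.sum_congr rfl fun k _ => ?_
  rw [Function.update_comm h, mul_left_comm]

end Operators

/-! ### The infinite tensor product and the action -/

section Algebra

variable (n : ℕ → ℕ) [∀ l, NeZero (n l)]

/-- The UHF algebra `⨂ₗ M_{nₗ}`, as the C*-algebra generated by the mutually commuting unital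
copies of the matrix algebras `M_{nₗ}` on `ℓ²(X)`. -/
def uhfSubalgebra : StarSubalgebra ℂ (Hilb n →L[ℂ] Hilb n) :=
  (⨆ l, (factorHom n l).range).topologicalClosure

instance : IsClosed (uhfSubalgebra n : Set (Hilb n →L[ℂ] Hilb n)) :=
  StarSubalgebra.isClosed_topologicalClosure _

/-- The UHF algebra `⨂ₗ M_{nₗ}` as a C*-algebra in its own right. -/
abbrev UHF : Type := uhfSubalgebra n

theorem factorHom_mem (l : ℕ) (a : Matrix (ZMod (n l)) (ZMod (n l)) ℂ) :
    factorHom n l a ∈ uhfSubalgebra n :=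
  StarSubalgebra.le_topologicalClosure _
    (le_iSup (fun l => (factorHom n l).range) l ⟨a, rfl⟩)

/-- The inclusion of the `l`-th tensor factor into `⨂ₗ M_{nₗ}`. -/
def factor (l : ℕ) : Matrix (ZMod (n l)) (ZMod (n l)) ℂ →⋆ₐ[ℂ] UHF n :=
  (factorHom n l).codRestrict (uhfSubalgebra n) (factorHom_mem n l)

instance : Nontrivial (UHF n) := by
  classical
  refine ⟨⟨1, 0, fun h => ?_⟩⟩
  have h1 : (1 : Hilb n →L[ℂ] Hilb n) = 0 := congrArg Subtype.val h
  have h2 := congrArg (fun T : Hilb n →L[ℂ] Hilb n => (T (lp.single 2 0 (1 : ℂ)) : Hilb n) 0) h1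
  simp at h2

/-- Each tensor factor is embedded faithfully. -/
theorem factor_injective (l : ℕ) : Function.Injective (factor n l) :=
  RingHom.injective (factor n l : Matrix (ZMod (n l)) (ZMod (n l)) ℂ →+* UHF n)

/-- The natural representation of `ℤ/nₗℤ` on `ℂ^{nₗ}` by cyclic permutations, `e_j ↦ e_{j+s}`. -/
def cyclicMatrix (l : ℕ) (s : ZMod (n l)) : Matrix (ZMod (n l)) (ZMod (n l)) ℂ :=
  Matrix.of fun i j => if i = j + s then 1 else 0

theorem conj_cyclicMatrix_apply (l : ℕ) (s : ZMod (n l))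
    (a : Matrix (ZMod (n l)) (ZMod (n l)) ℂ) (i j : ZMod (n l)) :
    (cyclicMatrix n l s * a * star (cyclicMatrix n l s)) i j = a (i - s) (j - s) := by
  have h : ∀ i k : ZMod (n l), (i = k + s) = (k = i - s) := fun i k =>
    propext ⟨fun h => by rw [h]; simp, fun h => by rw [h]; simp⟩
  simp [Matrix.mul_apply, cyclicMatrix, Matrix.star_apply, h]

theorem conj_translation_factorHom (g : CyclicProd n) (l : ℕ)
    (a : Matrix (ZMod (n l)) (ZMod (n l)) ℂ) :
    Unitary.conjStarAlgAut ℂ _ (translation n (Multiplicative.ofAdd g)) (factorHom n l a)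
      = factorHom n l (cyclicMatrix n l (g l) * a * star (cyclicMatrix n l (g l))) := by
  ext ξ x
  simp only [Unitary.conjStarAlgAut_apply, mul_apply_eq_comp, translation_apply,
    factorHom_apply, star_translation_apply, conj_cyclicMatrix_apply]
  rw [← (Equiv.subRight (g l)).sum_comp]
  refine Finset.sum_congr rfl fun j _ => ?_
  have h2 : Function.update (x - g) l (j - g l) + g = Function.update x l j := by
    ext m
    by_cases h : m = l
    · subst h; simp
    · simp [h]
  simp [h2]

theorem conj_translation_mem (g : Multiplicative (CyclicProd n)) {T : Hilb n →L[ℂ] Hilb n}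
    (hT : T ∈ uhfSubalgebra n) :
    Unitary.conjStarAlgAut ℂ _ (translation n g) T ∈ uhfSubalgebra n := by
  have hc : Continuous (Unitary.conjStarAlgAut ℂ (Hilb n →L[ℂ] Hilb n) (translation n g)) := by
    change Continuous fun T => (translation n g : Hilb n →L[ℂ] Hilb n) * T * _
    fun_prop
  have hle : (⨆ l, (factorHom n l).range) ≤ (uhfSubalgebra n).comap
      (Unitary.conjStarAlgAut ℂ (Hilb n →L[ℂ] Hilb n) (translation n g)).toStarAlgHom := by
    refine iSup_le fun l => ?_
    rintro _ ⟨a, rfl⟩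
    change Unitary.conjStarAlgAut ℂ _ (translation n (Multiplicative.ofAdd g.toAdd))
      (factorHom n l a) ∈ uhfSubalgebra n
    rw [conj_translation_factorHom]
    exact factorHom_mem n l _
  exact StarSubalgebra.topologicalClosure_minimal hle
    (IsClosed.preimage hc (StarSubalgebra.isClosed_topologicalClosure _)) hT

/-- The action of `∏ₗ ℤ/nₗℤ` on `⨂ₗ M_{nₗ}` by `⨂ₗ Ad(ρₗ(gₗ))`, where `ρₗ` is the natural
representation: conjugation by the translation unitary; see `prodAction_factor`. -/
def prodAction : Multiplicative (CyclicProd n) →* (UHF n ≃⋆ₐ[ℂ] UHF n) where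
  toFun g :=
    { toFun := fun T =>
        ⟨Unitary.conjStarAlgAut ℂ _ (translation n g) T, conj_translation_mem n g T.2⟩
      invFun := fun T =>
        ⟨Unitary.conjStarAlgAut ℂ _ (translation n g⁻¹) T, conj_translation_mem n g⁻¹ T.2⟩
      left_inv := fun T => Subtype.ext <| by
        dsimp only
        rw [← Unitary.conjStarAlgAut_mul_apply, ← map_mul]; simp
      right_inv := fun T => Subtype.ext <| by
        dsimp only
        rw [← Unitary.conjStarAlgAut_mul_apply, ← map_mul]; simp
      map_mul' := fun S T => Subtype.ext <| by simp only [MulMemClass.coe_mul, map_mul]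
      map_add' := fun S T => Subtype.ext <| by simp only [AddMemClass.coe_add, map_add]
      map_smul' := fun c T => Subtype.ext <| map_smul _ c (T : Hilb n →L[ℂ] Hilb n)
      map_star' := fun T => Subtype.ext <| map_star _ (T : Hilb n →L[ℂ] Hilb n) }
  map_one' := by
    ext T : 2
    change Unitary.conjStarAlgAut ℂ _ (translation n 1) (T : Hilb n →L[ℂ] Hilb n) = T
    simp
  map_mul' g h := by
    ext T : 2
    change Unitary.conjStarAlgAut ℂ _ (translation n (g * h)) (T : Hilb n →L[ℂ] Hilb n)
      = Unitary.conjStarAlgAut ℂ _ (translation n g)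
        (Unitary.conjStarAlgAut ℂ _ (translation n h) T)
    rw [map_mul, Unitary.conjStarAlgAut_mul_apply]

/-- On the `l`-th tensor factor the action is `Ad(ρₗ(gₗ))`. -/
theorem prodAction_factor (g : CyclicProd n) (l : ℕ) (a : Matrix (ZMod (n l)) (ZMod (n l)) ℂ) :
    prodAction n (Multiplicative.ofAdd g) (factor n l a)
      = factor n l (cyclicMatrix n l (g l) * a * star (cyclicMatrix n l (g l))) :=
  Subtype.ext (conj_translation_factorHom n g l a)

/-- The action of `G` on `⨂ₗ M_{nₗ}` obtained by composing `i : G → ∏ₗ ℤ/nₗℤ` with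
`prodAction`. -/
def modelAction {G : Type*} [AddCommGroup G] (i : G →+ CyclicProd n) :
    Multiplicative G →* (UHF n ≃⋆ₐ[ℂ] UHF n) :=
  (prodAction n).comp (AddMonoidHom.toMultiplicative i)

end Algebra

end UHFModel

end

/-! Everything depends on whether `i g` has finite or infinite support. If the support is finite,
the translation by `i g` is a finite product of permutation matrices, so it lies in the UHF algebra
and the automorphism is inner (`prodAction_inner`). Rokhlin projections almost commute with the
implementing unitary, so each is almost fixed, yet it is also almost moved to an orthogonal one;
this forces order 1 (`HasFiniteOrderRokhlin.eq_one_of_inner`). Since `i g` has finite order,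
injectivity of `i` gives `g = 0`.

Conversely, suppose `i g` is non-zero at arbitrarily late coordinates. Every element is approximated
by elements commuting with all late factors (`exists_near_commute`), so diagonal projections built
from late coordinates are approximately central. In finite order `k`, finitely many late coordinates
already see `g` with exact order `k`; colouring cosets cyclically gives projections that are
permuted exactly (`hasFiniteOrderRokhlin_prodAction`). For uniform outerness, the minimal diagonal
projections of one late factor are moved to orthogonal ones, and a perturbation argument cuts the
given projection by them (`isUniformlyOuter_of_partitions`). -/

namespace UHFModel

/-! ### Perturbation of projections, and Rokhlin conditions in a general C*-algebra. -/

section CStarPerturbation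

variable {A : Type*} [CStarAlgebra A]

theorem norm_le_one_of_star_mul_self_eq_one {u : A} (hu : star u * u = 1) : ‖u‖ ≤ 1 := by
  have h1 : ‖(1 : A)‖ ≤ 1 := IsStarProjection.norm_le _ (.one A)
  have h := CStarRing.norm_star_mul_self (x := u)
  rw [hu] at h
  nlinarith [norm_nonneg u]

/-- A self-adjoint element near a projection is near a projection in its functional calculus. -/
theorem exists_isStarProjection_near {p b : A} (hp : IsStarProjection p) (hb : IsSelfAdjoint b)
    {δ : ℝ} (hδ : δ ≤ 1 / 20) (hpb : ‖p - b‖ ≤ δ) :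
    ∃ f : ℝ → ℝ, IsStarProjection (cfc f b) ∧ ‖p - cfc f b‖ ≤ 13 * δ := by
  have hδ0 : 0 ≤ δ := (norm_nonneg _).trans hpb
  have hp1 : ‖p‖ ≤ 1 := IsStarProjection.norm_le p hp
  have hbp : ‖b - p‖ ≤ δ := by rwa [norm_sub_rev]
  have hb2 : ‖b‖ ≤ 2 := by
    have : ‖b‖ ≤ ‖b - p‖ + ‖p‖ := by simpa using norm_add_le (b - p) p
    linarith
  -- The factor 4 bounds `‖b‖ + ‖p‖ + 1`.
  have hsq : ‖b * b - b‖ ≤ 4 * δ := by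
    have e : b * b - b = b * (b - p) + (b - p) * p - (b - p) := by
      have := hp.isIdempotentElem.eq
      simp only [mul_sub, sub_mul, this]
      abel
    rw [e]
    refine (norm_sub_le _ _).trans ?_
    have h1 := norm_add_le (b * (b - p)) ((b - p) * p)
    have h2 := norm_mul_le b (b - p)
    have h3 := norm_mul_le (b - p) p
    nlinarith [norm_nonneg (b - p), norm_nonneg b, norm_nonneg p]
  have hspec : ∀ x ∈ spectrum ℝ b, |x * x - x| ≤ 4 * δ := by
    intro x hx
    have h := norm_apply_le_norm_cfc (fun x : ℝ => x * x - x) b hx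
    rw [cfc_sub (fun x : ℝ => x * x) (fun x => x) b, cfc_mul (fun x : ℝ => x) (fun x => x) b,
      cfc_id' ℝ b] at h
    exact h.trans hsq
  -- Between 1/3 and 2/3 one has `x - x * x > 2/9`, whereas `4 * δ ≤ 1/5`: the spectrum has a gap
  -- there.
  have hcases : ∀ x ∈ spectrum ℝ b, x ≤ 1 / 3 ∨ 2 / 3 ≤ x := by
    intro x hx
    by_contra! h
    have := (abs_le.1 (hspec x hx)).1
    nlinarith
  -- A continuous ramp across the gap, so on the spectrum it only takes the values 0 and 1.
  let f : ℝ → ℝ := fun x => max 0 (min 1 (3 * x - 1))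
  have hf0 : ∀ x : ℝ, x ≤ 1 / 3 → f x = 0 := fun x hx =>
    max_eq_left ((min_le_right _ _).trans (by linarith))
  have hf1 : ∀ x : ℝ, 2 / 3 ≤ x → f x = 1 := fun x hx => by
    have : min 1 (3 * x - 1) = 1 := min_eq_left (by linarith)
    simp [f, this]
  have hfc : Continuous f := by fun_prop
  refine ⟨f, ⟨?_, IsSelfAdjoint.cfc⟩, ?_⟩
  · change cfc f b * cfc f b = cfc f b
    rw [← cfc_mul f f b]
    refine cfc_congr fun x hx => ?_
    rcases hcases x hx with h | h
    · simp [hf0 x h]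
    · simp [hf1 x h]
  · have h1 : ‖b - cfc f b‖ ≤ 12 * δ := by
      have : cfc (fun x : ℝ => x - f x) b = b - cfc f b := by
        rw [cfc_sub (fun x : ℝ => x) f b, cfc_id' ℝ b]
      rw [← this]
      refine norm_cfc_le (by positivity) fun x hx => ?_
      have h2 := abs_le.1 (hspec x hx)
      rw [Real.norm_eq_abs, abs_le]
      rcases hcases x hx with h | h
      · rw [hf0 x h]
        constructor <;> rcases le_total 0 x with h0 | h0 <;> nlinarith
      · rw [hf1 x h]
        constructor <;> rcases le_total 1 x with h0 | h0 <;> nlinarith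
    calc ‖p - cfc f b‖ = ‖(p - b) + (b - cfc f b)‖ := by abel_nf
      _ ≤ ‖p - b‖ + ‖b - cfc f b‖ := norm_add_le _ _
      _ ≤ 13 * δ := by linarith

/-- Two close projections are conjugate by a unitary that is close to `1`. -/
theorem exists_unitary_conj_of_near {p q : A} (hp : IsStarProjection p) (hq : IsStarProjection q)
    {η : ℝ} (hη : η ≤ 1 / 4) (hpq : ‖p - q‖ ≤ η) :
    ∃ u : A, star u * u = 1 ∧ u * star u = 1 ∧ ‖u - 1‖ ≤ 4 * η ∧ star u * p * u = q := by
  have hη0 : 0 ≤ η := (norm_nonneg _).trans hpq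
  have hp1 : ‖p‖ ≤ 1 := IsStarProjection.norm_le p hp
  have hq1 : ‖q‖ ≤ 1 := IsStarProjection.norm_le q hq
  have hpp : p * p = p := hp.isIdempotentElem.eq
  have hqq : q * q = q := hq.isIdempotentElem.eq
  have hps : star p = p := hp.isSelfAdjoint.star_eq
  have hqs : star q = q := hq.isSelfAdjoint.star_eq
  -- The standard intertwiner of `p` and `q`; the unitary will be its polar part `z * r` with `r =
  -- (star z * z)^(-1/2)`.
  obtain ⟨z, hz⟩ : ∃ z, z = p * q + (1 - p) * (1 - q) := ⟨_, rfl⟩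
  have hpz : p * z = z * q := by
    rw [hz]
    simp only [mul_add, add_mul, mul_sub, sub_mul, one_mul, mul_one, ← mul_assoc, hpp]
    simp only [mul_assoc, hqq]
    abel
  have hzs : star z = q * p + (1 - q) * (1 - p) := by
    rw [hz]; simp [hps, hqs]
  have hsz : star z * p = q * star z := by
    have := congrArg star hpz
    simpa [hps, hqs] using this
  have hz1 : ‖z - 1‖ ≤ 2 * η := by
    have e : z - 1 = -(p * (p - q)) + (p - q) * q := by
      rw [hz]
      simp only [mul_sub, sub_mul, one_mul, mul_one, hpp, hqq]
      abel
    rw [e]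
    refine (norm_add_le _ _).trans ?_
    rw [norm_neg]
    have h2 := norm_mul_le p (p - q)
    have h3 := norm_mul_le (p - q) q
    nlinarith [norm_nonneg (p - q), norm_nonneg p, norm_nonneg q]
  -- Indeed `star z * z = 1 - (p - q)^2`, so the error is quadratic.
  have hzz : ‖star z * z - 1‖ ≤ η ^ 2 := by
    have e : star z * z - 1 = -((p - q) * (p - q)) := by
      rw [hzs, hz]
      have a1 : ∀ x, p * (p * x) = p * x := fun x => by rw [← mul_assoc, hpp]
      simp only [mul_add, add_mul, mul_sub, sub_mul, one_mul, mul_one, mul_assoc, a1, hpp, hqq]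
      abel
    rw [e, norm_neg]
    refine (norm_mul_le _ _).trans ?_
    nlinarith [norm_nonneg (p - q)]
  have hsa : IsSelfAdjoint (star z * z) := IsSelfAdjoint.star_mul_self z
  have hspec : ∀ x ∈ spectrum ℝ (star z * z), |x - 1| ≤ η ^ 2 := by
    intro x hx
    have h := norm_apply_le_norm_cfc (fun x : ℝ => x - 1) (star z * z) hx
    rw [cfc_sub (fun x : ℝ => x) (fun _ => 1) _, cfc_id' ℝ _, cfc_const_one ℝ _] at h
    exact h.trans hzz
  have hlow : ∀ x ∈ spectrum ℝ (star z * z), 1 / 4 ≤ x := by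
    intro x hx
    have := (abs_le.1 (hspec x hx)).1
    nlinarith
  let f : ℝ → ℝ := fun x => (√x)⁻¹
  have hfc : ContinuousOn f (spectrum ℝ (star z * z)) := by
    refine ContinuousOn.inv₀ Real.continuous_sqrt.continuousOn fun x hx => ?_
    have := hlow x hx
    exact (Real.sqrt_pos.2 (by linarith)).ne'
  obtain ⟨r, hr⟩ : ∃ r, r = cfc f (star z * z) := ⟨_, rfl⟩
  have hrs : star r = r := by rw [hr]; exact (IsSelfAdjoint.cfc).star_eq
  have hrzr : r * (star z * z) * r = 1 := by
    have h1 : r * (star z * z) * r = cfc (fun x : ℝ => f x * x * f x) (star z * z) := by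
      rw [cfc_mul (fun x => f x * x) f _, cfc_mul f (fun x : ℝ => x) _, cfc_id' ℝ _, hr]
    rw [h1, ← cfc_const_one ℝ (star z * z)]
    refine cfc_congr fun x hx => ?_
    have hx0 : 0 < x := by linarith [hlow x hx]
    have h2 : √x * √x = x := Real.mul_self_sqrt hx0.le
    have h3 : √x ≠ 0 := (Real.sqrt_pos.2 hx0).ne'
    change (√x)⁻¹ * x * (√x)⁻¹ = 1
    field_simp
    nlinarith
  have hr1 : ‖r - 1‖ ≤ 2 * η ^ 2 := by
    have h1 : r - 1 = cfc (fun x : ℝ => f x - 1) (star z * z) := by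
      rw [cfc_sub f (fun _ => 1) _, cfc_const_one ℝ _, hr]
    rw [h1]
    refine norm_cfc_le (by positivity) fun x hx => ?_
    have hx0 : 1 / 4 ≤ x := hlow x hx
    have h2 : √x * √x = x := Real.mul_self_sqrt (by linarith)
    have h3 : 1 / 2 ≤ √x := Real.le_sqrt_of_sq_le (by norm_num; linarith)
    have h4 := abs_le.1 (hspec x hx)
    have h5 : f x - 1 = (1 - √x) / √x := by
      change (√x)⁻¹ - 1 = _
      field_simp
    rw [h5, Real.norm_eq_abs, abs_le, div_le_iff₀ (by linarith), le_div_iff₀ (by linarith)]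
    constructor <;> rcases le_total 1 (√x) with h0 | h0 <;> nlinarith
  have hru : IsUnit r := by
    have : r = 1 - (1 - r) := by abel
    rw [this]
    refine isUnit_one_sub_of_norm_lt_one ?_
    rw [norm_sub_rev]
    nlinarith
  have hzu : IsUnit z := by
    have : z = 1 - (1 - z) := by abel
    rw [this]
    refine isUnit_one_sub_of_norm_lt_one ?_
    rw [norm_sub_rev]
    linarith
  have hu1 : star (z * r) * (z * r) = 1 := by
    rw [star_mul, hrs, ← hrzr]
    simp only [mul_assoc]
  -- `star z * z * q = star z * p * z = q * (star z * z)`, and commutation passes to the functional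
  -- calculus.
  have hqr : q * r = r * q := by
    have : Commute (star z * z) q := by
      change star z * z * q = q * (star z * z)
      rw [mul_assoc, ← hpz, ← mul_assoc, hsz, mul_assoc]
    rw [hr]
    exact (this.cfc_real f).eq.symm
  refine ⟨z * r, hu1, ?_, ?_, ?_⟩
  -- An invertible isometry is unitary.
  · have hu : IsUnit (z * r) := hzu.mul hru
    obtain ⟨v, hv⟩ := hu
    rw [← hv] at hu1 ⊢
    rw [Units.eq_inv_of_mul_eq_one_right hu1]
    simp
  · have e : z * r - 1 = (z - 1) * (r - 1) + (z - 1) + (r - 1) := by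
      simp only [mul_sub, sub_mul, one_mul, mul_one]
      abel
    rw [e]
    have h1 := norm_add_le ((z - 1) * (r - 1) + (z - 1)) (r - 1)
    have h2 := norm_add_le ((z - 1) * (r - 1)) (z - 1)
    have h3 := norm_mul_le (z - 1) (r - 1)
    have h4 : ‖z - 1‖ * ‖r - 1‖ ≤ 2 * η * (2 * η ^ 2) :=
      mul_le_mul hz1 hr1 (norm_nonneg _) (by positivity)
    nlinarith [mul_nonneg hη0 hη0, mul_nonneg hη0 (mul_nonneg hη0 hη0)]
  · have : p * (z * r) = z * r * q := by
      rw [← mul_assoc, hpz, mul_assoc, hqr, mul_assoc]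
    rw [mul_assoc, this, ← mul_assoc, hu1, one_mul]

/-- An automorphism is uniformly outer if it moves suitable approximately central partitions of
unity into pairwise orthogonal position. -/
theorem isUniformlyOuter_of_partitions (β : A ≃⋆ₐ[ℂ] A)
    (H : ∀ a b : A, ∀ δ : ℝ, 0 < δ → ∃ a' b' : A, ‖a - a'‖ < δ ∧ ‖b - b'‖ < δ ∧
      ∃ k : ℕ, 0 < k ∧ ∃ e : Fin k → A, (∀ i, IsStarProjection (e i)) ∧
        (∀ i j, i ≠ j → e i * e j = 0) ∧ ∑ i, e i = 1 ∧
        (∀ i, Commute (e i) a') ∧ (∀ i, Commute (e i) b') ∧ ∀ i, e i * β (e i) = 0) :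
    IsUniformlyOuter β := by
  intro a p hp _ ε hε
  -- With `13 * δ ≤ 1/4` the conjugating unitary exists and satisfies `‖u - 1‖ ≤ 52 * δ`; this error
  -- enters twice, hence 104.
  obtain ⟨δ, hδ0, hδ1, hδ2⟩ : ∃ δ : ℝ, 0 < δ ∧ δ ≤ 1 / 52 ∧ δ * (1 + 104 * ‖a‖) < ε := by
    refine ⟨min (1 / 52) (ε / (2 * (1 + 104 * ‖a‖))), by positivity, min_le_left _ _, ?_⟩
    have h0 : 0 < 1 + 104 * ‖a‖ := by positivity
    calc _ ≤ ε / (2 * (1 + 104 * ‖a‖)) * (1 + 104 * ‖a‖) :=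
          mul_le_mul_of_nonneg_right (min_le_right _ _) h0.le
      _ = ε / 2 := by field_simp
      _ < ε := by linarith
  obtain ⟨a', b', ha, hb, k, hk, e, hep, heo, hes, hea, heb, heβ⟩ := H a p δ hδ0
  -- The self-adjoint part of `b'` is as close to `p` and still commutes with the `e i`; so does the
  -- projection `q` from its functional calculus.
  obtain ⟨b, hbdef⟩ : ∃ b : A, b = (2⁻¹ : ℝ) • (b' + star b') := ⟨_, rfl⟩
  have hbs : IsSelfAdjoint b := by
    rw [hbdef]
    exact (IsSelfAdjoint.all (2⁻¹ : ℝ)).smul (IsSelfAdjoint.add_star_self b')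
  have hpb : ‖p - b‖ ≤ δ := by
    have e1 : p - b = (2⁻¹ : ℝ) • ((p - b') + star (p - b')) := by
      have h2 : p = (2⁻¹ : ℝ) • (p + p) := by rw [← two_smul ℝ p, smul_smul]; norm_num
      rw [hbdef, star_sub, hp.isSelfAdjoint.star_eq]
      nth_rewrite 1 [h2]
      rw [← smul_sub]
      congr 1
      abel
    rw [e1, norm_smul]
    have h3 := norm_add_le (p - b') (star (p - b'))
    rw [norm_star] at h3
    rw [Real.norm_of_nonneg (by norm_num)]
    linarith
  have hcb : ∀ i, Commute (e i) b := fun i => by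
    have h1 : Commute (e i) (star b') := by
      have h2 := (heb i).star_star
      rwa [(hep i).isSelfAdjoint.star_eq] at h2
    rw [hbdef]
    exact ((heb i).add_right h1).smul_right _
  obtain ⟨f, hq, hpq⟩ := exists_isStarProjection_near hp hbs (by linarith) hpb
  obtain ⟨u, hu1, hu2, hu3, hu4⟩ := exists_unitary_conj_of_near hp hq (by linarith) hpq
  obtain ⟨q, hqdef⟩ : ∃ q, q = cfc f b := ⟨_, rfl⟩
  rw [← hqdef] at hq hu4
  have hcq : ∀ i, q * e i = e i * q := fun i => by
    rw [hqdef]; exact ((hcb i).symm.cfc_real f).eq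
  have hu : ‖u‖ ≤ 1 := norm_le_one_of_star_mul_self_eq_one hu1
  have hqs : star q = q := hq.isSelfAdjoint.star_eq
  have hqq : q * q = q := hq.isIdempotentElem.eq
  have hp' : p = u * q * star u := by
    calc p = (u * star u) * p * (u * star u) := by rw [hu2]; simp
      _ = u * (star u * p * u) * star u := by simp only [mul_assoc]
      _ = _ := by rw [hu4]
  have hprod : ∀ x y : A, (u * x * star u) * (u * y * star u) = u * (x * y) * star u := by
    intro x y
    calc _ = u * x * (star u * u) * y * star u := by simp only [mul_assoc]
      _ = _ := by rw [hu1, mul_one]; simp only [mul_assoc]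
  -- The `q * e i` partition `q`; conjugation by `u` carries this to a partition of `p`.
  refine ⟨k, hk, fun i => u * (q * e i) * star u, ?_, ?_, ?_, ?_⟩
  · intro i
    have hei : e i * e i = e i := (hep i).isIdempotentElem.eq
    refine ⟨?_, ?_⟩
    · change (u * (q * e i) * star u) * (u * (q * e i) * star u) = _
      rw [hprod]
      congr 2
      calc q * e i * (q * e i) = q * (e i * q) * e i := by simp only [mul_assoc]
        _ = (q * q) * (e i * e i) := by rw [← hcq]; simp only [mul_assoc]
        _ = _ := by rw [hqq, hei]
    · change star _ = _
      simp only [star_mul, star_star, hqs, (hep i).isSelfAdjoint.star_eq]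
      rw [← hcq]
      simp only [mul_assoc]
  · intro i j hij
    rw [hprod]
    have : q * e i * (q * e j) = 0 := by
      calc q * e i * (q * e j) = q * (e i * q) * e j := by simp only [mul_assoc]
        _ = (q * q) * (e i * e j) := by rw [← hcq]; simp only [mul_assoc]
        _ = _ := by rw [heo i j hij, mul_zero]
    rw [this]
    simp
  · rw [← Finset.sum_mul, ← Finset.mul_sum, ← Finset.mul_sum, hes, mul_one]
    exact hp'
  · intro i
    have hβu : ‖β u‖ ≤ 1 := by rwa [StarAlgEquiv.norm_map]
    have hβe : ‖β (e i)‖ ≤ 1 := by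
      rw [StarAlgEquiv.norm_map]; exact IsStarProjection.norm_le _ (hep i)
    have hei : ‖e i‖ ≤ 1 := IsStarProjection.norm_le _ (hep i)
    have hq1 : ‖q‖ ≤ 1 := IsStarProjection.norm_le _ hq
    have hβq : ‖β q‖ ≤ 1 := by rwa [StarAlgEquiv.norm_map]
    -- Subtracting `a'` is free, because `e i * a' * β (e i) = a' * (e i * β (e i)) = 0`; what
    -- remains is small.
    obtain ⟨m, hm⟩ : ∃ m, m = star u * a * β u - a' := ⟨_, rfl⟩
    have hkey : u * (q * e i) * star u * a * β (u * (q * e i) * star u)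
        = (u * q) * (e i * m * β (e i)) * (β q * star (β u)) := by
      have h0 : e i * a' * β (e i) = 0 := by
        rw [(hea i).eq, mul_assoc, heβ, mul_zero]
      rw [hm, mul_sub, sub_mul, h0, sub_zero, hcq, ← hcq]
      nth_rewrite 2 [hcq]
      simp only [map_mul, map_star, mul_assoc]
    have hm1 : ‖m‖ ≤ δ * (1 + 104 * ‖a‖) := by
      have e1 : m = star u * a * (β (u - 1)) + star (u - 1) * a + (a - a') := by
        rw [hm]
        simp only [map_sub, map_one, star_sub, star_one, mul_sub, sub_mul, mul_one, one_mul]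
        abel
      have h1 : ‖star u * a * β (u - 1)‖ ≤ ‖a‖ * (4 * (13 * δ)) := by
        refine (norm_mul_le _ _).trans ?_
        rw [StarAlgEquiv.norm_map]
        refine mul_le_mul ?_ hu3 (norm_nonneg _) (norm_nonneg _)
        refine (norm_mul_le _ _).trans ?_
        rw [norm_star]
        exact mul_le_of_le_one_left (norm_nonneg _) hu
      have h2 : ‖star (u - 1) * a‖ ≤ 4 * (13 * δ) * ‖a‖ := by
        refine (norm_mul_le _ _).trans ?_
        rw [norm_star]
        exact mul_le_mul_of_nonneg_right hu3 (norm_nonneg _)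
      rw [e1]
      have h3 := norm_add_le (star u * a * (β (u - 1)) + star (u - 1) * a) (a - a')
      have h4 := norm_add_le (star u * a * (β (u - 1))) (star (u - 1) * a)
      linarith
    have hcontr : ∀ x y : A, ‖x‖ ≤ 1 → ‖x * y‖ ≤ ‖y‖ := fun x y hx =>
      (norm_mul_le _ _).trans (mul_le_of_le_one_left (norm_nonneg _) hx)
    have hcontr' : ∀ x y : A, ‖y‖ ≤ 1 → ‖x * y‖ ≤ ‖x‖ := fun x y hy =>
      (norm_mul_le _ _).trans (mul_le_of_le_one_right (norm_nonneg _) hy)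
    rw [hkey]
    calc _ ≤ ‖(u * q) * (e i * m * β (e i))‖ :=
          hcontr' _ _ ((hcontr _ _ hβq).trans (by rwa [norm_star]))
      _ ≤ ‖e i * m * β (e i)‖ := hcontr _ _ ((hcontr _ _ hu).trans hq1)
      _ ≤ ‖e i * m‖ := hcontr' _ _ hβe
      _ ≤ ‖m‖ := hcontr _ _ hei
      _ < ε := hm1.trans_lt hδ2

/-- An inner automorphism has the order `k` Rokhlin property only for `k = 1`. -/
theorem HasFiniteOrderRokhlin.eq_one_of_inner [Nontrivial A] {k : ℕ} {β : A ≃⋆ₐ[ℂ] A}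
    (h : HasFiniteOrderRokhlin k β) {u : A} (hu : u * star u = 1)
    (hβ : ∀ x, β x = u * x * star u) : k = 1 := by
  by_contra hk
  obtain ⟨p, hp, ho, hc, hr, hs⟩ := h (1 / 2) (by norm_num) {u}
  have hu1 : ‖star u‖ ≤ 1 := norm_le_one_of_star_mul_self_eq_one (by rwa [star_star])
  -- For `k = 0` this is vacuous, and the empty sum still contradicts `1 ≠ 0`.
  have hzero : ∀ i, p i = 0 := by
    intro i
    have h2 : 2 ≤ k := by have := i.pos; omega
    have hne : finRotate k i ≠ i := by
      obtain ⟨m, rfl⟩ : ∃ m, k = m + 2 := ⟨k - 2, by omega⟩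
      rw [finRotate_apply]
      simp
    have h3 : ‖β (p i) - p i‖ < 1 / 2 := by
      have e : β (p i) - p i = -((p i * u - u * p i) * star u) := by
        rw [hβ, sub_mul, mul_assoc (p i), hu, mul_one, neg_sub]
      rw [e, norm_neg]
      refine ((norm_mul_le _ _).trans (mul_le_of_le_one_right (norm_nonneg _) hu1)).trans_lt ?_
      exact hc i u (by simp)
    have h4 : ‖p i - p (finRotate k i)‖ < 1 := by
      calc _ = ‖(β (p i) - p (finRotate k i)) - (β (p i) - p i)‖ := by congr 1; abel
        _ ≤ _ := norm_sub_le _ _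
        _ < 1 := by linarith [hr i]
    have hii : p i * p i = p i := (hp i).isIdempotentElem.eq
    -- Orthogonality gives this identity; its last factor has norm below 1, so `p i` must vanish.
    have h5 : p i = p i * (p i - p (finRotate k i)) := by
      rw [mul_sub, ho _ _ hne.symm, sub_zero, hii]
    by_contra h0
    have h6 : ‖p i‖ ≤ ‖p i‖ * ‖p i - p (finRotate k i)‖ := by
      nth_rewrite 1 [h5]; exact norm_mul_le _ _
    nlinarith [norm_pos_iff.2 h0]
  simp [hzero] at hs

end CStarPerturbation

end UHFModel

namespace UHFModel

/-! ### Cyclic colourings of translations. -/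

section Coloring

/-- A translation by an element of finite order `k` can be coloured cyclically by `Fin k`. -/
theorem exists_cyclic_coloring {H : Type*} [AddCommGroup H] {h : H} {k : ℕ} (hk : 0 < k)
    (hord : addOrderOf h = k) : ∃ c : H → Fin k, ∀ x, c (x + h) = finRotate k (c x) := by
  obtain ⟨k, rfl⟩ := Nat.exists_eq_succ_of_ne_zero hk.ne'
  let π : H → H ⧸ AddSubgroup.zmultiples h := QuotientAddGroup.mk
  have hex : ∀ x : H, ∃ m : ℤ, m • h = -(π x).out + x := fun x =>
    AddSubgroup.mem_zmultiples_iff.1 (QuotientAddGroup.eq.1 (QuotientAddGroup.out_eq' (π x)))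
  choose m hm using hex
  -- Writing `x` as its coset representative plus `m x • h`, the colour is `m x` modulo the order of
  -- `h`; `ZMod (k + 1)` unfolds to `Fin (k + 1)`.
  refine ⟨fun x => (m x : ZMod (k + 1)), fun x => ?_⟩
  have hπ : π (x + h) = π x :=
    QuotientAddGroup.eq.2 (by simp)
  have h1 : (m (x + h) - (m x + 1)) • h = 0 := by
    rw [sub_smul, add_smul, one_smul, hm, hm, hπ]
    abel
  have h2 := addOrderOf_dvd_iff_zsmul_eq_zero.2 h1
  rw [hord] at h2
  have h3 := (ZMod.intCast_zmod_eq_zero_iff_dvd _ (k + 1)).2 h2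
  push_cast at h3
  exact (sub_eq_zero.1 h3).trans (finRotate_apply (n := k + 1) _).symm

end Coloring

variable {n : ℕ → ℕ} [∀ l, NeZero (n l)]

/-! ### Finitely supported elements act by inner automorphisms. -/

section Inner

theorem translation_single (l : ℕ) (s : ZMod (n l)) :
    (translation n (Multiplicative.ofAdd (Pi.single l s)) : Hilb n →L[ℂ] Hilb n)
      = factorHom n l (cyclicMatrix n l s) := by
  ext ξ x
  have h : ∀ j : ZMod (n l), (x l = j + s) = (j = x l - s) := fun j =>
    propext ⟨fun h => by rw [h]; simp, fun h => by rw [h]; simp⟩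
  have h2 : x - Pi.single l s = Function.update x l (x l - s) := by
    ext m
    by_cases h : m = l
    · subst h; simp
    · simp [h]
  simp [factorHom_apply, cyclicMatrix, h, h2]

/-- Translations by elements of the direct sum belong to the UHF algebra. -/
theorem translation_mem {g : CyclicProd n} (hg : g ∈ cyclicSum n) :
    (translation n (Multiplicative.ofAdd g) : Hilb n →L[ℂ] Hilb n) ∈ uhfSubalgebra n := by
  have key : ∀ s : Finset ℕ, (translation n (Multiplicative.ofAdd
      (∑ l ∈ s, Pi.single l (g l))) : Hilb n →L[ℂ] Hilb n) ∈ uhfSubalgebra n := by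
    intro s
    induction s using Finset.induction_on with
    | empty => simp
    | insert l s hl ih =>
      rw [Finset.sum_insert hl, ofAdd_add, map_mul, Submonoid.coe_mul, translation_single]
      exact mul_mem (factorHom_mem n l _) ih
  have hfin : {l | g l ≠ 0}.Finite := hg
  have hsum : g = ∑ l ∈ hfin.toFinset, Pi.single l (g l) := by
    ext m
    rw [Finset.sum_apply]
    by_cases hm : g m = 0
    · rw [Finset.sum_eq_zero, hm]
      intro l _
      by_cases h : m = l
      · subst h; simp [hm]
      · simp [h]
    · rw [Finset.sum_eq_single m]
      · simp
      · intro l _ h; simp [h.symm]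
      · intro h; simp [hm] at h
  rw [hsum]
  exact key _

theorem prodAction_inner {g : CyclicProd n} (hg : g ∈ cyclicSum n) :
    ∃ u : UHF n, u * star u = 1 ∧
      ∀ x, prodAction n (Multiplicative.ofAdd g) x = u * x * star u :=
  ⟨⟨_, translation_mem hg⟩, Subtype.ext (Unitary.coe_mul_star_self _), fun _ => rfl⟩

end Inner

/-! ### Approximation by elements commuting with late tensor factors. -/

section Approximation

/-- The operators that commute with all but finitely many tensor factors. -/
def eventualCommutant (n : ℕ → ℕ) [∀ l, NeZero (n l)] :
    StarSubalgebra ℂ (Hilb n →L[ℂ] Hilb n) where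
  carrier := {T | ∃ L, ∀ m, L ≤ m → ∀ c, Commute T (factorHom n m c)}
  mul_mem' := by
    rintro S T ⟨L, hL⟩ ⟨M, hM⟩
    exact ⟨max L M, fun m hm c => (hL m (le_of_max_le_left hm) c).mul_left
      (hM m (le_of_max_le_right hm) c)⟩
  add_mem' := by
    rintro S T ⟨L, hL⟩ ⟨M, hM⟩
    exact ⟨max L M, fun m hm c => (hL m (le_of_max_le_left hm) c).add_left
      (hM m (le_of_max_le_right hm) c)⟩
  algebraMap_mem' r := ⟨0, fun _ _ _ => Algebra.commute_algebraMap_left r _⟩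
  star_mem' := by
    rintro T ⟨L, hL⟩
    refine ⟨L, fun m hm c => ?_⟩
    have h := (hL m hm (star c)).star_star
    rwa [← map_star, star_star] at h

/-- Each element is a limit of elements that commute with all but finitely many factors. -/
theorem exists_near_commute (x : UHF n) {δ : ℝ} (hδ : 0 < δ) :
    ∃ y : UHF n, ‖x - y‖ < δ ∧ ∃ L, ∀ m, L ≤ m → ∀ c, Commute y (factor n m c) := by
  -- Only generators need checking. The bound depends on the element, so the closure itself is
  -- reached by approximation.
  have hle : (⨆ l, (factorHom n l).range) ≤ eventualCommutant n := by
    refine iSup_le fun l => ?_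
    rintro _ ⟨a, rfl⟩
    exact ⟨l + 1, fun m hm c => factorHom_commute (by omega) a c⟩
  have hx : (x : Hilb n →L[ℂ] Hilb n) ∈
      closure ((⨆ l, (factorHom n l).range : StarSubalgebra ℂ (Hilb n →L[ℂ] Hilb n)) :
        Set (Hilb n →L[ℂ] Hilb n)) := x.2
  obtain ⟨y, hy, hxy⟩ := Metric.mem_closure_iff.1 hx δ hδ
  obtain ⟨L, hL⟩ := hle hy
  refine ⟨⟨y, StarSubalgebra.le_topologicalClosure _ hy⟩, ?_, L, fun m hm c => ?_⟩
  · rw [dist_eq_norm] at hxy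
    exact hxy
  · exact Subtype.ext (hL m hm c).eq

end Approximation

/-! ### Diagonal projections from functions of finitely many coordinates. -/

section Diagonal

/-- Multiplication by a function of finitely many coordinates belongs to the UHF algebra, and
commutes with whatever commutes with the factors concerned. -/
theorem exists_multiplication (s : Finset ℕ) (f : CyclicProd n → ℂ)
    (hf : ∀ x y, (∀ l ∈ s, x l = y l) → f x = f y) :
    ∃ T : UHF n, (∀ ξ x, (T : Hilb n →L[ℂ] Hilb n) ξ x = f x * ξ x) ∧
      ∀ y : UHF n, (∀ l ∈ s, ∀ c, Commute y (factor n l c)) → Commute y T := by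
  induction s using Finset.induction_on generalizing f with
  | empty =>
    refine ⟨algebraMap ℂ _ (f 0), fun ξ x => ?_, fun y _ => Algebra.commute_algebraMap_right _ _⟩
    rw [hf x 0 (by simp)]
    rfl
  | insert l s hl ih =>
    have hv : ∀ v : ZMod (n l), ∀ x y : CyclicProd n, (∀ m ∈ s, x m = y m) →
        f (Function.update x l v) = f (Function.update y l v) := by
      intro v x y hxy
      refine hf _ _ fun m hm => ?_
      by_cases h : m = l
      · subst h; simp
      · rw [Function.update_of_ne h, Function.update_of_ne h]
        exact hxy m ((Finset.mem_insert.1 hm).resolve_left h)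
    choose T hT hTc using fun v => ih (fun x => f (Function.update x l v)) (hv v)
    -- Split `f` by the value `v` of coordinate `l`: the matrix unit is the indicator of `x l = v`,
    -- and `T v` multiplies by `f` with that coordinate frozen at `v`.
    refine ⟨∑ v, factor n l (Matrix.single v v 1) * T v, fun ξ x => ?_, fun y hy => ?_⟩
    · have h1 : ((∑ v, factor n l (Matrix.single v v 1) * T v : UHF n) : Hilb n →L[ℂ] Hilb n)
          = ∑ v, factorHom n l (Matrix.single v v 1) * (T v : Hilb n →L[ℂ] Hilb n) := by
        rw [AddSubmonoidClass.coe_finsetSum]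
        rfl
      rw [h1]
      simp only [sum_apply, lp.coeFn_sum, Finset.sum_apply, mul_apply_eq_comp, factorHom_apply,
        hT, Matrix.single_apply, Function.update_idem]
      rw [Finset.sum_eq_single (x l)]
      · rw [Finset.sum_eq_single (x l)] <;> simp +contextual [eq_comm]
      · intro v _ hvx
        simp [hvx]
      · simp
    · refine Commute.sum_right _ _ _ fun v _ => ?_
      exact (hy l (Finset.mem_insert_self l s) _).mul_right
        (hTc v y fun m hm => hy m (Finset.mem_insert_of_mem hm))

theorem eq_of_apply_eq {S T : UHF n}
    (h : ∀ ξ x, (S : Hilb n →L[ℂ] Hilb n) ξ x = (T : Hilb n →L[ℂ] Hilb n) ξ x) : S = T :=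
  Subtype.ext (by ext ξ x; exact h ξ x)

theorem star_eq_of_real_multiplication {T : UHF n} {f : CyclicProd n → ℂ}
    (hT : ∀ ξ x, (T : Hilb n →L[ℂ] Hilb n) ξ x = f x * ξ x) (hf : ∀ x, star (f x) = f x) :
    star T = T := by
  refine Subtype.ext ?_
  change star (T : Hilb n →L[ℂ] Hilb n) = T
  rw [ContinuousLinearMap.star_eq_adjoint, eq_comm, ContinuousLinearMap.eq_adjoint_iff]
  intro ξ η
  rw [lp.inner_eq_tsum, lp.inner_eq_tsum]
  refine tsum_congr fun x => ?_
  have := hf x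
  rw [hT, hT]
  simp only [RCLike.inner_apply, map_mul, starRingEnd_apply, this]
  ring

theorem prodAction_multiplication {T : UHF n} {f : CyclicProd n → ℂ}
    (hT : ∀ ξ x, (T : Hilb n →L[ℂ] Hilb n) ξ x = f x * ξ x) (g : CyclicProd n)
    (ξ : Hilb n) (x : CyclicProd n) :
    (prodAction n (Multiplicative.ofAdd g) T : Hilb n →L[ℂ] Hilb n) ξ x = f (x - g) * ξ x := by
  change ((translation n (Multiplicative.ofAdd g) : Hilb n →L[ℂ] Hilb n) *
    (T : Hilb n →L[ℂ] Hilb n) *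
    star (translation n (Multiplicative.ofAdd g) : Hilb n →L[ℂ] Hilb n)) ξ x = _
  simp only [mul_apply_eq_comp, translation_apply, hT, star_translation_apply, sub_add_cancel]

/-- A colouring that depends on finitely many coordinates yields a partition of unity by diagonal
projections. -/
theorem exists_coloring_projections {K : Type*} [Fintype K] [DecidableEq K] (s : Finset ℕ)
    (c : CyclicProd n → K) (hc : ∀ x y, (∀ l ∈ s, x l = y l) → c x = c y) :
    ∃ p : K → UHF n,
      (∀ j ξ x, (p j : Hilb n →L[ℂ] Hilb n) ξ x = (if c x = j then 1 else 0) * ξ x) ∧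
      (∀ j, IsStarProjection (p j)) ∧ (∀ i j, i ≠ j → p i * p j = 0) ∧ ∑ j, p j = 1 ∧
      ∀ j, ∀ y : UHF n, (∀ l ∈ s, ∀ a, Commute y (factor n l a)) → Commute (p j) y := by
  choose p hp hpc using fun j => exists_multiplication s (fun x => if c x = j then (1 : ℂ) else 0)
    (fun x y h => by rw [hc x y h])
  have hmul : ∀ i j ξ x, ((p i * p j : UHF n) : Hilb n →L[ℂ] Hilb n) ξ x
      = (if c x = i then 1 else 0) * ((if c x = j then 1 else 0) * ξ x) := by
    intro i j ξ x
    rw [MulMemClass.coe_mul, mul_apply_eq_comp, hp, hp]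
  refine ⟨p, hp, fun j => ⟨?_, ?_⟩, fun i j hij => ?_, ?_, fun j y hy => (hpc j y hy).symm⟩
  · refine eq_of_apply_eq fun ξ x => ?_
    rw [hmul, hp]
    split_ifs <;> simp
  · exact star_eq_of_real_multiplication (hp j) fun x => by split_ifs <;> simp
  · refine eq_of_apply_eq fun ξ x => ?_
    rw [hmul]
    by_cases h : c x = i
    · simp [h, hij]
    · simp [h]
  · refine eq_of_apply_eq fun ξ x => ?_
    rw [AddSubmonoidClass.coe_finsetSum]
    simp only [sum_apply, lp.coeFn_sum, Finset.sum_apply, hp]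
    rw [← Finset.sum_mul]
    simp

end Diagonal

/-! ### Rokhlin conditions for infinitely supported elements. -/

section Rokhlin

/-- An element of the product that is not in the direct sum acts by a uniformly outer
automorphism. -/
theorem isUniformlyOuter_prodAction {g : CyclicProd n} (hg : g ∉ cyclicSum n) :
    IsUniformlyOuter (prodAction n (Multiplicative.ofAdd g)) := by
  refine isUniformlyOuter_of_partitions _ fun a b δ hδ => ?_
  obtain ⟨a', ha, L, hL⟩ := exists_near_commute a hδ
  obtain ⟨b', hb, M, hM⟩ := exists_near_commute b hδ
  have hinf : {l | g l ≠ 0}.Infinite := hg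
  -- One coordinate past both bounds suffices: its diagonal projections commute with `a'` and `b'`,
  -- and `g l ≠ 0` moves each to an orthogonal one.
  obtain ⟨l, hl, hlt⟩ := hinf.exists_gt (max L M)
  let e : ZMod (n l) ≃ Fin (Fintype.card (ZMod (n l))) := Fintype.equivFin _
  obtain ⟨p, hp, hpp, hpo, hps, hpc⟩ := exists_coloring_projections (n := n) {l}
    (fun x => e (x l)) (fun x y h => by rw [h l (by simp)])
  refine ⟨a', b', ha, hb, _, Fintype.card_pos, p, hpp, hpo, hps, fun i => ?_, fun i => ?_,
    fun i => ?_⟩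
  · refine hpc i a' fun m hm c => hL m ?_ c
    rw [Finset.mem_singleton.1 hm]
    exact (le_max_left _ _).trans hlt.le
  · refine hpc i b' fun m hm c => hM m ?_ c
    rw [Finset.mem_singleton.1 hm]
    exact (le_max_right _ _).trans hlt.le
  · refine eq_of_apply_eq fun ξ x => ?_
    rw [MulMemClass.coe_mul, mul_apply_eq_comp, hp, prodAction_multiplication (hp i)]
    by_cases h : e (x l) = i
    · have h2 : e ((x - g) l) ≠ i := by
        rw [← h]
        intro h3
        have h4 := e.injective h3
        rw [Pi.sub_apply, sub_eq_self] at h4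
        exact hl h4
      simp only [h2, if_false]
      simp
    · simp [h]

/-- If no non-zero multiple of an element of order `k > 0` is in the direct sum, then it acts with
the order `k` Rokhlin property. -/
theorem hasFiniteOrderRokhlin_prodAction {g : CyclicProd n} {k : ℕ} (hk : 0 < k)
    (hgk : k • g = 0) (hg : ∀ j, 0 < j → j < k → j • g ∉ cyclicSum n) :
    HasFiniteOrderRokhlin k (prodAction n (Multiplicative.ofAdd g)) := by
  classical
  intro ε hε F
  choose y hy L hL using fun a : UHF n => exists_near_commute a (half_pos hε)
  obtain ⟨N, hN⟩ : ∃ N, ∀ a ∈ F, L a ≤ N := ⟨F.sup L, fun a ha => Finset.le_sup ha⟩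
  -- One late coordinate for each proper multiple `j • g`, witnessing that it is non-zero; outside
  -- `0 < j < k` the value is a dummy.
  have hex : ∀ j, ∃ l, 0 < j → j < k → N ≤ l ∧ (j • g) l ≠ 0 := by
    intro j
    by_cases h : 0 < j ∧ j < k
    · have hinf : {l | (j • g) l ≠ 0}.Infinite := hg j h.1 h.2
      obtain ⟨l, hl, hlt⟩ := hinf.exists_gt N
      exact ⟨l, fun _ _ => ⟨hlt.le, hl⟩⟩
    · exact ⟨0, fun h1 h2 => (h ⟨h1, h2⟩).elim⟩
  choose l hl using hex
  obtain ⟨s, hs⟩ : ∃ s : Finset ℕ, s = (Finset.Ioo 0 k).image l := ⟨_, rfl⟩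
  have hsN : ∀ m ∈ s, N ≤ m := by
    intro m hm
    rw [hs, Finset.mem_image] at hm
    obtain ⟨j, hj, rfl⟩ := hm
    rw [Finset.mem_Ioo] at hj
    exact (hl j hj.1 hj.2).1
  let r : CyclicProd n → ∀ m : s, ZMod (n m) := fun x m => x m
  -- The chosen witnesses keep every proper multiple non-zero after restriction to `s`.
  have hord : addOrderOf (r g) = k := by
    rw [addOrderOf_eq_iff hk]
    refine ⟨?_, fun j hjk hj0 h0 => ?_⟩
    · ext m
      exact congrFun hgk m
    · have hmem : l j ∈ s := by
        rw [hs]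
        exact Finset.mem_image_of_mem l (Finset.mem_Ioo.2 ⟨hj0, hjk⟩)
      exact (hl j hj0 hjk).2 (congrFun h0 ⟨l j, hmem⟩)
  obtain ⟨c, hc⟩ := exists_cyclic_coloring hk hord
  obtain ⟨p, hp, hpp, hpo, hps, hpc⟩ := exists_coloring_projections s (fun x => c (r x))
    (fun x y h => congrArg c (funext fun m => h m m.2))
  refine ⟨p, hpp, hpo, fun i a ha => ?_, fun i => ?_, hps⟩
  · have hcomm : Commute (p i) (y a) :=
      hpc i (y a) fun m hm b => hL a m ((hN a ha).trans (hsN m hm)) b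
    -- Only the approximation error contributes, once on each side, hence the choice of `ε / 2`.
    have e : p i * a - a * p i = p i * (a - y a) - (a - y a) * p i := by
      simp only [mul_sub, sub_mul, hcomm.eq]
      abel
    have hp1 : ‖p i‖ ≤ 1 := IsStarProjection.norm_le _ (hpp i)
    rw [e]
    have h1 := norm_sub_le (p i * (a - y a)) ((a - y a) * p i)
    have h2 := (norm_mul_le (p i) (a - y a)).trans (mul_le_of_le_one_left (norm_nonneg _) hp1)
    have h3 := (norm_mul_le (a - y a) (p i)).trans (mul_le_of_le_one_right (norm_nonneg _) hp1)
    linarith [hy a]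
  · have e : prodAction n (Multiplicative.ofAdd g) (p i) = p (finRotate k i) := by
      refine eq_of_apply_eq fun ξ x => ?_
      rw [prodAction_multiplication (hp i), hp]
      have h1 : c (r x) = finRotate k (c (r (x - g))) := by
        rw [← hc]
        congr 1
        ext m
        simp [r]
      simp only [h1, (finRotate k).injective.eq_iff]
    rw [e, sub_self, norm_zero]
    exact hε

end Rokhlin

end UHFModel

/-! ### The equivalence. -/

theorem mainTheorem1 (n : ℕ → ℕ) [∀ l, NeZero (n l)] (hn : UHFModel.IsUniversalType n)
    {G : Type*} [AddCommGroup G] (i : G →+ UHFModel.CyclicProd n)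
    (hi : Function.Injective i) :
    UHFModel.HasRokhlinProperty (UHFModel.modelAction n i) ↔
      i.range ⊓ UHFModel.cyclicSum n = ⊥ := by
  have hmodel : ∀ g : G, UHFModel.modelAction n i (Multiplicative.ofAdd g)
      = UHFModel.prodAction n (Multiplicative.ofAdd (i g)) := fun _ => rfl
  constructor
  · intro h
    rw [eq_bot_iff]
    rintro _ ⟨⟨g, rfl⟩, hg⟩
    obtain ⟨u, hu, hβ⟩ := UHFModel.prodAction_inner hg
    -- The product of the `n l` over the finite support kills `i g`, so the finite-order clause of
    -- the Rokhlin property applies to `g`.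
    have hfin : 0 < addOrderOf g := by
      rw [← addOrderOf_injective i hi g, addOrderOf_pos_iff]
      have hs : {l | i g l ≠ 0}.Finite := hg
      refine isOfFinAddOrder_iff_nsmul_eq_zero.2
        ⟨∏ l ∈ hs.toFinset, n l, Finset.prod_pos fun l _ => NeZero.pos (n l), ?_⟩
      ext l
      by_cases hl : i g l = 0
      · simp [hl]
      · have hdvd : n l ∣ ∏ l ∈ hs.toFinset, n l := Finset.dvd_prod_of_mem n (by simpa using hl)
        rw [Pi.smul_apply, nsmul_eq_mul, (ZMod.natCast_eq_zero_iff _ _).2 hdvd, zero_mul]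
        rfl
    have h1 := ((h g).1 hfin).eq_one_of_inner hu (fun x => by rw [hmodel, hβ])
    rw [AddMonoid.addOrderOf_eq_one_iff] at h1
    simp [h1]
  · intro h
    have hout : ∀ g : G, g ≠ 0 → i g ∉ UHFModel.cyclicSum n := by
      intro g hg hmem
      have : i g ∈ i.range ⊓ UHFModel.cyclicSum n := ⟨⟨g, rfl⟩, hmem⟩
      rw [h, AddSubgroup.mem_bot] at this
      exact hg (hi (by rw [this, map_zero]))
    refine fun g => ⟨fun hk => ?_, fun h0 j hj => ?_⟩
    · rw [hmodel]
      refine UHFModel.hasFiniteOrderRokhlin_prodAction hk ?_ fun j hj hjk => ?_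
      · rw [← map_nsmul, addOrderOf_nsmul_eq_zero, map_zero]
      · rw [← map_nsmul]
        exact hout _ fun hz => (addOrderOf_le_of_nsmul_eq_zero hj hz).not_gt hjk
    -- The `j`-th power of the automorphism is the action of `j • g`, which is non-zero because `g`
    -- has infinite order.
    · rw [← map_pow, ← ofAdd_nsmul, hmodel]
      refine UHFModel.isUniformlyOuter_prodAction (hout _ fun hz => ?_)
      exact addOrderOf_eq_zero_iff'.1 h0 j hj hz
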